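/- **Setting.** Let $d\in\{2,3\}$, and let $n=d$ or $(d,n)=(2,3)$; vectors $x\in\mathbb R^d$ are also regarded as vectors $(x,0)\in\mathbb R^n$. Let $\mathsf F\in\mathbb R^{d\times d}$ with $\det\mathsf F=1$, $\mathcal L=\mathsf F\mathbb Z^d$, $S\ge 1$, and $p_0,\dots,p_{S-1}\in\mathbb R^d$ with $p_0=0$. Let $\mathcal R\subset\mathcal L\times\{0,\dots,S-1\}^2$ be finite, containing no $(0\alpha\alpha)$, and such that $\operatorname{span}\{\rho : (\rho\alpha\alpha)\in\mathcal R\}=\mathbb R^d$ for every $\alpha$ and $(0\alpha\beta)\in\mathcal R$ for all $\alpha\ne\beta$. Put $\mathcal R_1=\{\rho:\exists\,\alpha,\beta,\ (\rho\alpha\beta)\in\mathcal R\}$. For $\boldsymbol u=(u_\alpha)_{\alpha=0}^{S-1}$, $u_\alpha:\mathcal L\to\mathbb R^n$, let $D\boldsymbol u(\xi)=\big(u_\beta(\xi+\rho)-u_\alpha(\xi)\big)_{(\rho\alpha\beta)\in\mathcal R}$. Let $y_\alpha(\xi)=\xi+p_\alpha$ be the reference configuration, and let $\hat V:(\mathbb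 R^n)^{\mathcal R}\to\mathbb R$ be four times continuously differentiable with its derivatives of orders $1$ to $4$ bounded. Since $D\boldsymbol y(\xi)$ does not depend on $\xi$, set $V(\boldsymbol g)=\hat V(D\boldsymbol y+\boldsymbol g)-\hat V(D\boldsymbol y)$ and $$\mathcal E^{\rm a}_{\rm hom}(\boldsymbol u)=\sum_{\xi\in\mathcal L}V(D\boldsymbol u(\xi)),\qquad \mathcal E^{\rm c}(U,\boldsymbol p)=\int_{\mathbb R^d}V\Big(\big(\nabla U(x)\rho+p_\beta(x)-p_\alpha(x)\big)_{(\rho\alpha\beta)\in\mathcal R}\Big)\,dx .$$ Write $\langle\delta^2\mathcal E(0)v,v\rangle=\frac{d^2}{dt^2}\big|_{t=0}\mathcal E(tv)$ for the second variation of either energy at $0$. Let $\|\boldsymbol v\|_{{\rm a}_1}^2=\sum_{\xi\in\mathcal L}\sum_{(\rho\alpha\beta)\in\mathcal R}|v_\beta(\xi+\rho)-v_\alpha(\xi)|^2$, and let $\mathcal U_0$ be the set of all $\boldsymbol v$ with $\|\boldsymbol v\|_{{\rm a}_1}<\infty$ such that the functions $\xi\mapsto v_0(\xi+\rho)-v_0(\xi)$,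 $\rho\in\mathcal R_1$, and $v_\alpha-v_0$, $0\le\alpha<S$, have finite support. **Theorem (Cauchy–Born stability).** Suppose that the reference configuration is phonon stable, that is, there is $\gamma_{\rm a}>0$ with $$\langle\delta^2\mathcal E^{\rm a}_{\rm hom}(0)\boldsymbol v,\boldsymbol v\rangle\ \ge\ \gamma_{\rm a}\|\boldsymbol v\|_{{\rm a}_1}^2\qquad\text{for all }\boldsymbol v\in\mathcal U_0 .$$ Then there is a constant $\gamma_{\rm c}>0$ such that, for every $Z\in H^1_{\rm loc}(\mathbb R^d,\mathbb R^n)$ and all $q_0,\dots,q_{S-1}\in L^2(\mathbb R^d,\mathbb R^n)$ for which $\nabla Z$ and every $q_\alpha$ have compact support, the integral defining $\mathcal E^{\rm c}(tZ,t\boldsymbol q)$ converges absolutely for every $t\in\mathbb R$, the function $t\mapsto\mathcal E^{\rm c}(tZ,t\boldsymbol q)$ is twice continuously differentiable, and $$\langle\delta^2\mathcal E^{\rm c}(0)(Z,\boldsymbol q),(Z,\boldsymbol q)\rangle\ \ge\ \gamma_{\rm c}\Big(\|\nabla Z\|_{L^2(\mathbb R^d)}^2+\sum_{\alpha=0}^{S-1}\|q_\alpha-q_0\|_{L^2(\mathbb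 R^d)}^2\Big).$$ -/

import Mathlib

open MeasureTheory

noncomputable section

namespace CauchyBorn

/-- `ℝ^m` with its Euclidean norm. -/
abbrev E (m : ℕ) : Type := EuclideanSpace ℝ (Fin m)

/-- The Bravais lattice `F ℤ^d`. -/
def bravaisLattice {d : ℕ} (F : Matrix (Fin d) (Fin d) ℝ) : AddSubgroup (E d) where
  carrier := {x | ∃ z : Fin d → ℤ, x = WithLp.toLp 2 (F.mulVec fun i => (z i : ℝ))}
  zero_mem' := ⟨0, by ext i; simp [Matrix.mulVec, dotProduct]⟩
  add_mem' := by
    rintro _ _ ⟨z, rfl⟩ ⟨w, rfl⟩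
    refine ⟨z + w, ?_⟩
    ext i
    simp [Matrix.mulVec, dotProduct, mul_add, Finset.sum_add_distrib]
  neg_mem' := by
    rintro _ ⟨z, rfl⟩
    refine ⟨-z, ?_⟩
    ext i
    simp [Matrix.mulVec, dotProduct]

/-- A multilattice `⋃_α (F ℤ^d + p_α)` with `S` species, `det F = 1` and `p_0 = 0`, together with
a finite interaction range `R` whose elements `(ρ, α, β)` stand for the bond from species `α` at a
site `ξ` to species `β` at the site `ξ + ρ`. -/
structure Multilattice (d S : ℕ) [NeZero S] where
  F : Matrix (Fin d) (Fin d) ℝ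
  det_F : F.det = 1
  p : Fin S → E d
  p_zero : p 0 = 0
  R : Finset (bravaisLattice F × Fin S × Fin S)
  not_mem_R : ∀ α : Fin S, ((0 : bravaisLattice F), α, α) ∉ R
  span_R : ∀ α : Fin S,
    Submodule.span ℝ {x : E d | ∃ ρ : bravaisLattice F, (ρ, α, α) ∈ R ∧ x = (ρ : E d)} = ⊤
  zero_mem_R : ∀ α β : Fin S, α ≠ β → ((0 : bravaisLattice F), α, β) ∈ R

/-- The canonical embedding `ℝ^d → ℝ^n`, `x ↦ (x, 0)`, used for `n ≥ d` (the identity if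
`n = d`). -/
def embed (d n : ℕ) (x : E d) : E n :=
  WithLp.toLp 2 fun i => if h : (i : ℕ) < d then x ⟨i, h⟩ else 0

/-- The second variation `⟨δ²𝓔(0)v, v⟩` of an energy at the zero state in direction `v`. -/
def secondVariation {X : Type*} [AddCommGroup X] [Module ℝ X] (energy : X → ℝ) (v : X) : ℝ :=
  iteratedDeriv 2 (fun t : ℝ => energy (t • v)) 0

namespace Multilattice

variable {d S : ℕ} [NeZero S] (M : Multilattice d S) (n : ℕ)

/-- The lattice of sites. -/
abbrev L : Type := bravaisLattice M.F

/-- Arguments of the site potential: one vector of `ℝ^n` for every bond in `R`. -/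
abbrev Stencil : Type := {r // r ∈ M.R} → E n

/-- Multilattice deformations or displacements: `u α ξ` belongs to species `α` at site `ξ`. -/
abbrev Displacement : Type := Fin S → M.L → E n

/-- The projection of the interaction range onto its lattice component. -/
def R₁ : Set M.L := {ρ | ∃ α β : Fin S, (ρ, α, β) ∈ M.R}

variable {n}

/-- `D_{(ραβ)} u(ξ) = u_β(ξ + ρ) - u_α(ξ)`, collected over `(ραβ) ∈ R`. -/
def D (u : M.Displacement n) (ξ : M.L) : M.Stencil n :=
  fun r => u r.1.2.2 (ξ + r.1.1) - u r.1.2.1 ξ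

variable (n)

/-- The reference deformation `y_α(ξ) = ξ + p_α`. -/
def reference : M.Displacement n := fun α ξ => embed d n ((ξ : E d) + M.p α)

/-- The stencil `Dy` of the reference deformation. -/
def refStencil : M.Stencil n := M.D (M.reference n) 0

/-- `Dy(ξ)` does not depend on the site `ξ`. -/
theorem D_reference (ξ : M.L) : M.D (M.reference n) ξ = M.refStencil n := by
  funext r
  ext i
  by_cases h : (i : ℕ) < d
  · simp only [D, refStencil, reference, embed, h, PiLp.sub_apply, PiLp.add_apply,
      AddSubgroup.coe_add, AddSubgroup.coe_zero, PiLp.zero_apply, dite_true]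
    ring
  · simp [D, refStencil, reference, embed, h]

variable {n}

/-- Regularity of the homogeneous site potential: four times continuously differentiable with
uniformly bounded derivatives. -/
def RegularPotential (Vhat : M.Stencil n → ℝ) : Prop :=
  ContDiff ℝ 4 Vhat ∧
    ∀ j : ℕ, 1 ≤ j → j ≤ 4 → ∃ C : ℝ, ∀ g, ‖iteratedFDeriv ℝ j Vhat g‖ ≤ C

/-- The site potential as a function of the displacement stencil:
`V(g) = V̂(Dy + g) - V̂(Dy)`. -/
def V (Vhat : M.Stencil n → ℝ) (g : M.Stencil n) : ℝ :=
  Vhat (M.refStencil n + g) - Vhat (M.refStencil n)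

/-- The energy `𝓔ᵃ_hom` of the homogeneous lattice (a finite sum for displacements in `𝓤₀`). -/
def atomisticEnergy (Vhat : M.Stencil n → ℝ) (u : M.Displacement n) : ℝ :=
  ∑' ξ : M.L, M.V Vhat (M.D u ξ)

/-- `|Du(ξ)|_R²`. -/
def stencilNormSq (g : M.Stencil n) : ℝ := ∑ r, ‖g r‖ ^ 2

/-- `‖u‖²_{a₁} = ∑_ξ |Du(ξ)|_R²`. -/
def energyNormSq (u : M.Displacement n) : ℝ := ∑' ξ : M.L, M.stencilNormSq (M.D u ξ)

/-- The test displacements `𝓤₀`: finite energy norm, and `Du_0` and all `u_α - u_0` have compact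
(that is, finite) support in the lattice. -/
def IsTestDisplacement (v : M.Displacement n) : Prop :=
  (Summable fun ξ : M.L => M.stencilNormSq (M.D v ξ)) ∧
  (∀ ρ ∈ M.R₁, (Function.support fun ξ : M.L => v 0 (ξ + ρ) - v 0 ξ).Finite) ∧
  ∀ α : Fin S, (Function.support fun ξ : M.L => v α ξ - v 0 ξ).Finite

/-- Phonon stability of the reference configuration: there is `γ_a > 0` with
`⟨δ²𝓔ᵃ_hom(0)v, v⟩ ≥ γ_a ‖v‖²_{a₁}` for all `v ∈ 𝓤₀`. -/
def PhononStable (Vhat : M.Stencil n → ℝ) : Prop :=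
  ∃ γₐ : ℝ, 0 < γₐ ∧ ∀ v : M.Displacement n, M.IsTestDisplacement v →
    γₐ * M.energyNormSq v ≤ secondVariation (M.atomisticEnergy Vhat) v

/-- Continuum fields `(∇U, p)`, the displacement entering through its gradient. -/
abbrev Fields (_ : Multilattice d S) (n : ℕ) : Type :=
  (E d → E d →L[ℝ] E n) × (Fin S → E d → E n)

/-- The Cauchy–Born stencil `(∇_ρ U(x) + p_β(x) - p_α(x))_{(ραβ) ∈ R}`. -/
def continuumStencil (w : M.Fields n) (x : E d) : M.Stencil n :=
  fun r => w.1 x (r.1.1 : E d) + w.2 r.1.2.2 x - w.2 r.1.2.1 x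

/-- The Cauchy–Born energy `𝓔ᶜ`, with the shifts kept as independent fields. -/
def cauchyBornEnergy (Vhat : M.Stencil n → ℝ) (w : M.Fields n) : ℝ :=
  ∫ x, M.V Vhat (M.continuumStencil w x)

/-- `‖(U, p)‖²_c = ‖∇U‖²_{L²} + ∑_α ‖p_α - p_0‖²_{L²}`, with the Frobenius norm of `∇U(x)`. -/
def continuumNormSq (w : M.Fields n) : ℝ :=
  (∫ x, ∑ i : Fin d, ‖w.1 x (EuclideanSpace.single i 1)‖ ^ 2) +
    ∑ α : Fin S, ∫ x, ‖w.2 α x - w.2 0 x‖ ^ 2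

end Multilattice

/-- `f ∈ L²_loc`. -/
def MemL2Loc {d : ℕ} {Y : Type*} [NormedAddCommGroup Y] (f : E d → Y) : Prop :=
  ∀ K : Set (E d), IsCompact K → MemLp f 2 (volume.restrict K)

/-- `G` is the weak gradient of `Z`. -/
def IsWeakGradient {d n : ℕ} (Z : E d → E n) (G : E d → E d →L[ℝ] E n) : Prop :=
  ∀ φ : E d → ℝ, ContDiff ℝ (⊤ : ℕ∞) φ → HasCompactSupport φ → ∀ e : E d,
    ∫ x, fderiv ℝ φ x e • Z x = -∫ x, φ x • G x e

/-- `Z ∈ H¹_loc` with weak gradient `G`. -/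
def IsH1LocWithGradient {d n : ℕ} (Z : E d → E n) (G : E d → E d →L[ℝ] E n) : Prop :=
  MemL2Loc Z ∧ MemL2Loc G ∧ IsWeakGradient Z G

/-- Compact support of a function that is defined up to null sets. -/
def AECompactSupport {d : ℕ} {Y : Type*} [Zero Y] (f : E d → Y) : Prop :=
  ∃ K : Set (E d), IsCompact K ∧ ∀ᵐ x, x ∉ K → f x = 0

end CauchyBorn

end

/-! The second variation of either energy is one quadratic form, the Hessian of the site potential
at the reference stencil, summed over lattice stencils or integrated over continuum stencils.
Subtracting `γ` times the squared stencil norm gives a form `Q` (`stabilityForm`), and phonon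
stability says that the lattice sums of `Q` are nonnegative on test displacements.

For regular fields, sample `ε⁻¹ Z + q` on the lattice at scale `ε` with an arbitrary offset.
Integrating the lattice sums over all offsets in a fundamental domain unfolds them into an integral
over `ℝ^d` of `Q` at difference quotients (`integral_differenceStencil_nonneg`). As `ε → 0` these
become gradients (`integral_continuumStencil_nonneg_of_regular`).

General fields are mollified; Jensen and Fatou carry the sign to the limit
(`integral_nonneg_of_mollify`). Finally the stencil norm controls gradient and relative shifts, by
the spanning condition and the bonds within a site (`exists_continuum_coercivity`). -/

noncomputable section

namespace CauchyBorn

/-! ### Second derivatives of sums and integrals along a line -/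

section Line

variable {W : Type*} [NormedAddCommGroup W] [NormedSpace ℝ W] {f : W → ℝ}

theorem hasDerivAt_comp_line (hf : ContDiff ℝ 2 f) (a g : W) (t : ℝ) :
    HasDerivAt (fun t : ℝ => f (a + t • g)) (fderiv ℝ f (a + t • g) g) t := by
  have hl : HasDerivAt (fun t : ℝ => a + t • g) g t := by
    simpa using ((hasDerivAt_id t).smul_const g).const_add a
  exact ((hf.differentiable (by norm_num)) (a + t • g)).hasFDerivAt.comp_hasDerivAt t hl

theorem hasDerivAt_fderiv_comp_line (hf : ContDiff ℝ 2 f) (a g : W) (t : ℝ) :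
    HasDerivAt (fun t : ℝ => fderiv ℝ f (a + t • g) g)
      (fderiv ℝ (fderiv ℝ f) (a + t • g) g g) t := by
  have hl : HasDerivAt (fun t : ℝ => a + t • g) g t := by
    simpa using ((hasDerivAt_id t).smul_const g).const_add a
  have h1 : ContDiff ℝ 1 (fderiv ℝ f) := hf.fderiv_right (by norm_num)
  have h2 : HasDerivAt (fun t : ℝ => fderiv ℝ f (a + t • g))
      (fderiv ℝ (fderiv ℝ f) (a + t • g) g) t :=
    ((h1.differentiable (by norm_num)) (a + t • g)).hasFDerivAt.comp_hasDerivAt t hl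
  simpa using h2.clm_apply (hasDerivAt_const t g)

theorem abs_sub_le_of_fderiv_bound (hf : ContDiff ℝ 2 f) {C : ℝ} (hC : ∀ x, ‖fderiv ℝ f x‖ ≤ C)
    (a g : W) : |f (a + g) - f a| ≤ C * ‖g‖ := by
  have := Convex.norm_image_sub_le_of_norm_fderiv_le (𝕜 := ℝ) (f := f) (s := Set.univ) (C := C)
    (fun x _ => (hf.differentiable (by norm_num)) x) (fun x _ => hC x) convex_univ
    (Set.mem_univ a) (Set.mem_univ (a + g))
  simpa using this

theorem iteratedDeriv_two_sum_line (hf : ContDiff ℝ 2 f) (a : W) {ι : Type*} (s : Finset ι)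
    (g : ι → W) :
    iteratedDeriv 2 (fun t : ℝ => ∑ i ∈ s, (f (a + t • g i) - f a)) 0 =
      ∑ i ∈ s, fderiv ℝ (fderiv ℝ f) a (g i) (g i) := by
  have h1 : deriv (fun t : ℝ => ∑ i ∈ s, (f (a + t • g i) - f a)) =
      fun t => ∑ i ∈ s, fderiv ℝ f (a + t • g i) (g i) := by
    funext t
    exact (HasDerivAt.fun_sum fun i _ =>
      (hasDerivAt_comp_line hf a (g i) t).sub_const (f a)).deriv
  rw [iteratedDeriv_succ, iteratedDeriv_one, h1]
  simpa using (HasDerivAt.fun_sum (u := s) fun i _ =>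
    (hasDerivAt_fderiv_comp_line hf a (g i) 0)).deriv

variable {X : Type*} [MeasurableSpace X] {μ : Measure X} {g : X → W}

theorem integrable_comp_line (hf : ContDiff ℝ 2 f) {C : ℝ} (hC : ∀ x, ‖fderiv ℝ f x‖ ≤ C)
    (a : W) (hg : Integrable g μ) (t : ℝ) :
    Integrable (fun x => f (a + t • g x) - f a) μ := by
  refine (hg.smul t).norm.const_mul C |>.mono' ?_ ?_
  · exact (hf.continuous.comp (continuous_const.add continuous_id)
      |>.sub continuous_const).comp_aestronglyMeasurable (hg.smul t).aestronglyMeasurable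
  · exact Filter.Eventually.of_forall fun x => abs_sub_le_of_fderiv_bound hf hC a (t • g x)

/-- The derivative bounds are global, so `C₁ ‖g‖` and `C₂ ‖g‖ ^ 2` dominate the two derivatives of
the integrand for all `t` at once; this allows differentiating twice under the integral and gives
continuity of the result. -/
theorem contDiff_two_integral_line (hf : ContDiff ℝ 2 f) {C₁ C₂ : ℝ}
    (hC₁ : ∀ x, ‖fderiv ℝ f x‖ ≤ C₁) (hC₂ : ∀ x, ‖fderiv ℝ (fderiv ℝ f) x‖ ≤ C₂)
    (a : W) (hg : Integrable g μ) (hg2 : Integrable (fun x => ‖g x‖ ^ 2) μ) :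
    ContDiff ℝ 2 (fun t : ℝ => ∫ x, (f (a + t • g x) - f a) ∂μ) ∧
      iteratedDeriv 2 (fun t : ℝ => ∫ x, (f (a + t • g x) - f a) ∂μ) 0 =
        ∫ x, fderiv ℝ (fderiv ℝ f) a (g x) (g x) ∂μ := by
  have hc1 : Continuous (fderiv ℝ f) := hf.continuous_fderiv (by norm_num)
  have hc2 : Continuous (fderiv ℝ (fderiv ℝ f)) :=
    (hf.fderiv_right (m := 1) (by norm_num)).continuous_fderiv (by norm_num)
  have hm1 : ∀ t : ℝ, AEStronglyMeasurable (fun x => fderiv ℝ f (a + t • g x) (g x)) μ := fun t =>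
    (((hc1.comp (continuous_const.add (continuous_const_smul t))).clm_apply
      continuous_id).comp_aestronglyMeasurable hg.aestronglyMeasurable)
  have hm2 : ∀ t : ℝ, AEStronglyMeasurable
      (fun x => fderiv ℝ (fderiv ℝ f) (a + t • g x) (g x) (g x)) μ := fun t =>
    ((((hc2.comp (continuous_const.add (continuous_const_smul t))).clm_apply
      continuous_id).clm_apply continuous_id).comp_aestronglyMeasurable hg.aestronglyMeasurable)
  have hb1 : ∀ (t : ℝ) (x : X), ‖fderiv ℝ f (a + t • g x) (g x)‖ ≤ C₁ * ‖g x‖ := fun t x =>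
    (fderiv ℝ f (a + t • g x)).le_of_opNorm_le (hC₁ _) _
  have hb2 : ∀ (t : ℝ) (x : X),
      ‖fderiv ℝ (fderiv ℝ f) (a + t • g x) (g x) (g x)‖ ≤ C₂ * ‖g x‖ ^ 2 := fun t x => by
    have h1 := (fderiv ℝ (fderiv ℝ f) (a + t • g x)).le_of_opNorm_le (hC₂ _) (g x)
    calc _ ≤ ‖fderiv ℝ (fderiv ℝ f) (a + t • g x) (g x)‖ * ‖g x‖ :=
          ContinuousLinearMap.le_opNorm _ _
      _ ≤ C₂ * ‖g x‖ * ‖g x‖ := by gcongr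
      _ = _ := by ring
  have hd1 : ∀ t : ℝ, HasDerivAt (fun t : ℝ => ∫ x, (f (a + t • g x) - f a) ∂μ)
      (∫ x, fderiv ℝ f (a + t • g x) (g x) ∂μ) t := fun t =>
    (hasDerivAt_integral_of_dominated_loc_of_deriv_le (s := Set.univ)
      (bound := fun x => C₁ * ‖g x‖) Filter.univ_mem
      (Filter.Eventually.of_forall fun s => (integrable_comp_line hf hC₁ a hg s).1)
      (integrable_comp_line hf hC₁ a hg t) (hm1 t)
      (Filter.Eventually.of_forall fun x s _ => hb1 s x) (hg.norm.const_mul _)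
      (Filter.Eventually.of_forall fun x s _ =>
        (hasDerivAt_comp_line hf a (g x) s).sub_const (f a))).2
  have hd2 : ∀ t : ℝ, HasDerivAt (fun t : ℝ => ∫ x, fderiv ℝ f (a + t • g x) (g x) ∂μ)
      (∫ x, fderiv ℝ (fderiv ℝ f) (a + t • g x) (g x) (g x) ∂μ) t := fun t =>
    (hasDerivAt_integral_of_dominated_loc_of_deriv_le (s := Set.univ)
      (bound := fun x => C₂ * ‖g x‖ ^ 2) Filter.univ_mem
      (Filter.Eventually.of_forall hm1)
      ((hg.norm.const_mul C₁).mono' (hm1 t) (Filter.Eventually.of_forall (hb1 t))) (hm2 t)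
      (Filter.Eventually.of_forall fun x s _ => hb2 s x) (hg2.const_mul _)
      (Filter.Eventually.of_forall fun x s _ => hasDerivAt_fderiv_comp_line hf a (g x) s)).2
  have e1 : deriv (fun t : ℝ => ∫ x, (f (a + t • g x) - f a) ∂μ) =
      fun t => ∫ x, fderiv ℝ f (a + t • g x) (g x) ∂μ := funext fun t => (hd1 t).deriv
  have e2 : deriv (fun t : ℝ => ∫ x, fderiv ℝ f (a + t • g x) (g x) ∂μ) =
      fun t => ∫ x, fderiv ℝ (fderiv ℝ f) (a + t • g x) (g x) (g x) ∂μ :=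
    funext fun t => (hd2 t).deriv
  constructor
  · rw [show (2 : WithTop ℕ∞) = 1 + 1 by norm_num, contDiff_succ_iff_deriv, e1,
      contDiff_one_iff_deriv, e2]
    refine ⟨fun t => (hd1 t).differentiableAt, by simp, fun t => (hd2 t).differentiableAt, ?_⟩
    refine continuous_of_dominated hm2 (fun t => Filter.Eventually.of_forall (hb2 t))
      (hg2.const_mul _) (Filter.Eventually.of_forall fun x => ?_)
    exact ((hc2.comp (continuous_const.add (continuous_id.smul continuous_const))).clm_apply
      continuous_const).clm_apply continuous_const
  · rw [iteratedDeriv_succ, iteratedDeriv_one, e1, e2]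
    simp

end Line

/-! ### Fundamental domain of the Bravais lattice and unfolding -/

section Lattice

variable {d : ℕ}

/-- The columns of an invertible matrix as a basis of `ℝ^d`. -/
def columnBasis (F : Matrix (Fin d) (Fin d) ℝ) (hF : IsUnit F.det) :
    Module.Basis (Fin d) ℝ (E d) :=
  ((Pi.basisFun ℝ (Fin d)).map (Matrix.toLinearEquiv' F
    ((Matrix.isUnit_iff_isUnit_det F).2 hF).invertible)).map
    (WithLp.linearEquiv 2 ℝ (Fin d → ℝ)).symm

theorem columnBasis_apply (F : Matrix (Fin d) (Fin d) ℝ) (hF : IsUnit F.det) (i : Fin d) :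
    columnBasis F hF i = WithLp.toLp 2 (F.col i) := by
  simp [columnBasis, Matrix.toLinearEquiv']

theorem bravaisLattice_eq_span (F : Matrix (Fin d) (Fin d) ℝ) (hF : IsUnit F.det) :
    bravaisLattice F =
      (Submodule.span ℤ (Set.range (columnBasis F hF))).toAddSubgroup := by
  ext x
  rw [Submodule.mem_toAddSubgroup, Submodule.mem_span_range_iff_exists_fun]
  have key : ∀ z : Fin d → ℤ, ∑ i, z i • columnBasis F hF i =
      WithLp.toLp 2 (F.mulVec fun i => (z i : ℝ)) := by
    intro z
    ext j
    simp [columnBasis_apply, Matrix.mulVec, dotProduct, mul_comm]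
  constructor
  · rintro ⟨z, rfl⟩
    exact ⟨z, key z⟩
  · rintro ⟨z, rfl⟩
    exact ⟨z, key z⟩

instance (F : Matrix (Fin d) (Fin d) ℝ) : Countable (bravaisLattice F) := by
  have : Set.Countable {x : E d | ∃ z : Fin d → ℤ,
      x = WithLp.toLp 2 (F.mulVec fun i => (z i : ℝ))} :=
    (Set.countable_range fun z : Fin d → ℤ => WithLp.toLp 2 (F.mulVec fun i => (z i : ℝ))).mono
      (by rintro x ⟨z, rfl⟩; exact ⟨z, rfl⟩)
  exact this.to_subtype

theorem finite_bravaisLattice_of_isBounded (F : Matrix (Fin d) (Fin d) ℝ) (hF : IsUnit F.det)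
    {s : Set (E d)} (hs : Bornology.IsBounded s) :
    {ξ : bravaisLattice F | (ξ : E d) ∈ s}.Finite := by
  refine Set.Finite.of_finite_image (f := ((↑) : bravaisLattice F → E d)) ?_
    Subtype.coe_injective.injOn
  refine (ZSpan.setFinite_inter (columnBasis F hF) hs).subset ?_
  rintro _ ⟨ξ, hξ, rfl⟩
  exact ⟨hξ, (bravaisLattice_eq_span F hF).le ξ.2⟩

theorem exists_isAddFundamentalDomain (F : Matrix (Fin d) (Fin d) ℝ) (hF : IsUnit F.det) :
    ∃ s : Set (E d), IsAddFundamentalDomain (bravaisLattice F) s volume := by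
  rw [bravaisLattice_eq_span F hF]
  exact ⟨_, ZSpan.isAddFundamentalDomain' (columnBasis F hF) volume⟩

/-- A function whose lattice sums over all translates of the lattice are nonnegative has
nonnegative integral. -/
theorem integral_nonneg_of_tsum_nonneg (F : Matrix (Fin d) (Fin d) ℝ) (hF : IsUnit F.det)
    {f : E d → ℝ} (hf : Integrable f)
    (h : ∀ x, 0 ≤ ∑' ξ : bravaisLattice F, f ((ξ : E d) + x)) : 0 ≤ ∫ x, f x := by
  obtain ⟨s, hs⟩ := exists_isAddFundamentalDomain F hF
  have hm : ∀ ξ : bravaisLattice F,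
      AEStronglyMeasurable (fun x => f ((ξ : E d) + x)) (volume.restrict s) := fun ξ =>
    (hf.comp_add_left (ξ : E d)).aestronglyMeasurable.restrict
  have e : ∫ x, f x = ∑' ξ : bravaisLattice F, ∫ x in s, f ((ξ : E d) + x) :=
    hs.integral_eq_tsum'' f hf
  have e' : ∫⁻ x, ‖f x‖ₑ = ∑' ξ : bravaisLattice F, ∫⁻ x in s, ‖f ((ξ : E d) + x)‖ₑ :=
    hs.lintegral_eq_tsum'' fun x => ‖f x‖ₑ
  -- Unfolding the norm in the same way turns the condition for exchanging sum and integral into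
  -- integrability of `f`.
  rw [e, ← integral_tsum hm (by rw [← e']; exact hf.2.ne)]
  exact integral_nonneg h

end Lattice

/-! ### Sampling regular fields on the lattice and the limit of small spacing -/

theorem add_eq_of_fderiv_eq_zero {d n : ℕ} {Z : E d → E n} (hZ : ContDiff ℝ 1 Z) {R : ℝ}
    (hR : ∀ x, R < ‖x‖ → fderiv ℝ Z x = 0) {x h : E d} (hx : R + ‖h‖ < ‖x‖) :
    Z (x + h) = Z x := by
  -- The closed ball of radius `‖h‖` about `x` lies where the derivative vanishes, so the mean value
  -- inequality holds there with constant `0`.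
  have := Convex.norm_image_sub_le_of_norm_fderiv_le (𝕜 := ℝ) (f := Z)
    (s := Metric.closedBall x ‖h‖) (C := 0) (x := x) (y := x + h)
    (fun y _ => (hZ.differentiable (by norm_num)) y) (fun y hy => ?_) (convex_closedBall _ _)
    (by simp) (by simp)
  · rw [zero_mul] at this
    exact sub_eq_zero.1 (norm_le_zero_iff.1 this)
  · rw [hR y, norm_zero]
    have h1 : ‖y - x‖ ≤ ‖h‖ := by simpa [dist_eq_norm] using hy
    have h2 : ‖x‖ ≤ ‖y‖ + ‖y - x‖ := by
      calc ‖x‖ = ‖y - (y - x)‖ := by congr 1; abel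
        _ ≤ _ := norm_sub_le _ _
    linarith

namespace Multilattice

variable {d n S : ℕ} [NeZero S] (M : Multilattice d S)

theorem isUnit_det_F : IsUnit M.F.det := by simp [M.det_F]

/-- The Cauchy–Born stencil with gradients replaced by difference quotients of step `ε`. -/
def differenceStencil (ε : ℝ) (Z : E d → E n) (q : Fin S → E d → E n) (x : E d) : M.Stencil n :=
  fun r => ε⁻¹ • (Z (x + ε • (r.1.1 : E d)) - Z x) + q r.1.2.2 (x + ε • (r.1.1 : E d)) -
    q r.1.2.1 x

/-- The lattice sampling at scale `ε`, with offset `x`, of a continuum displacement. -/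
def sample (ε : ℝ) (Z : E d → E n) (q : Fin S → E d → E n) (x : E d) : M.Displacement n :=
  fun α ξ => ε⁻¹ • Z (ε • ((ξ : E d) + x)) + q α (ε • ((ξ : E d) + x))

/-- The weight `ε⁻¹` on `Z` alone turns lattice differences into difference quotients and leaves
shifts at order one. -/
theorem D_sample (ε : ℝ) (Z : E d → E n) (q : Fin S → E d → E n) (x : E d) (ξ : M.L) :
    M.D (M.sample ε Z q x) ξ = M.differenceStencil ε Z q (ε • ((ξ : E d) + x)) := by
  funext r
  have : ε • (((ξ + r.1.1 : M.L) : E d) + x) = ε • ((ξ : E d) + x) + ε • (r.1.1 : E d) := by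
    rw [AddSubgroup.coe_add]; module
  simp only [D, sample, differenceStencil, this]
  module

theorem finite_site_of_norm_le {ε : ℝ} (hε : 0 < ε) (x : E d) (R : ℝ) :
    {ξ : M.L | ‖ε • ((ξ : E d) + x)‖ ≤ R}.Finite := by
  refine (finite_bravaisLattice_of_isBounded M.F M.isUnit_det_F
    (Metric.isBounded_closedBall (x := (0 : E d)) (r := ε⁻¹ * R + ‖x‖))).subset ?_
  intro ξ hξ
  simp only [Set.mem_ofPred_eq, norm_smul, Real.norm_of_nonneg hε.le] at hξ
  have h1 : ‖(ξ : E d) + x‖ ≤ ε⁻¹ * R := by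
    rw [inv_mul_eq_div, le_div_iff₀ hε]; linarith
  have h2 : ‖(ξ : E d)‖ ≤ ‖(ξ : E d) + x‖ + ‖x‖ := by
    simpa using norm_sub_le ((ξ : E d) + x) x
  simp only [Set.mem_ofPred_eq, Metric.mem_closedBall, dist_zero_right]
  linarith

theorem exists_bond_bound : ∃ P : ℝ, ∀ r : {r // r ∈ M.R}, ‖(r.1.1 : E d)‖ ≤ P := by
  obtain ⟨P, hP⟩ := (Set.finite_range fun r : {r // r ∈ M.R} => ‖(r.1.1 : E d)‖).bddAbove
  exact ⟨P, fun r => hP ⟨r, rfl⟩⟩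

section Smooth

variable {Z : E d → E n} {q : Fin S → E d → E n} (hZ : ContDiff ℝ 1 Z)
  (hq : ∀ α, Continuous (q α)) {R : ℝ} (hZR : ∀ x, R < ‖x‖ → fderiv ℝ Z x = 0)
  (hqR : ∀ α x, R < ‖x‖ → q α x = 0)

include hZ hZR hqR in
theorem differenceStencil_eq_zero {ε : ℝ} {x : E d}
    (hx : ∀ r : {r // r ∈ M.R}, R + ‖ε • (r.1.1 : E d)‖ < ‖x‖) :
    M.differenceStencil ε Z q x = 0 := by
  funext r
  have h1 := norm_sub_le (x + ε • (r.1.1 : E d)) (ε • (r.1.1 : E d))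
  rw [add_sub_cancel_right] at h1
  have h2 := hx r
  have h3 := norm_nonneg (ε • (r.1.1 : E d))
  simp only [differenceStencil]
  rw [add_eq_of_fderiv_eq_zero hZ hZR h2, hqR _ x (by linarith), hqR _ _ (by linarith)]
  simp

include hZ hZR hqR in
-- `Z` need not vanish far away, but its increments do, and only increments and relative shifts
-- enter the definition.
theorem isTestDisplacement_sample {ε : ℝ} (hε : 0 < ε) (x : E d) :
    M.IsTestDisplacement (M.sample ε Z q x) := by
  refine ⟨?_, fun ρ _ => ?_, fun α => ?_⟩
  · obtain ⟨P, hP⟩ := M.exists_bond_bound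
    refine summable_of_hasFiniteSupport
      ((M.finite_site_of_norm_le hε x (R + ε * P)).subset fun ξ hξ => ?_)
    by_contra hξ'
    refine hξ ?_
    have h0 : M.D (M.sample ε Z q x) ξ = 0 := by
      rw [D_sample]
      refine M.differenceStencil_eq_zero hZ hZR hqR fun r => ?_
      have : ε * ‖(r.1.1 : E d)‖ ≤ ε * P := mul_le_mul_of_nonneg_left (hP r) hε.le
      rw [norm_smul, Real.norm_of_nonneg hε.le]
      simp only [Set.mem_ofPred_eq, not_le] at hξ'
      linarith
    simp [h0, stencilNormSq]
  · refine (M.finite_site_of_norm_le hε x (R + ‖ε • (ρ : E d)‖)).subset fun ξ hξ => ?_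
    by_contra hξ'
    refine hξ ?_
    simp only [Set.mem_ofPred_eq, not_le] at hξ'
    have e : ε • (((ξ + ρ : M.L) : E d) + x) = ε • ((ξ : E d) + x) + ε • (ρ : E d) := by
      rw [AddSubgroup.coe_add]; module
    have h1 := norm_sub_le (ε • ((ξ : E d) + x) + ε • (ρ : E d)) (ε • (ρ : E d))
    rw [add_sub_cancel_right] at h1
    have h3 := norm_nonneg (ε • (ρ : E d))
    simp only [sample, e]
    rw [add_eq_of_fderiv_eq_zero hZ hZR hξ', hqR _ (ε • ((ξ : E d) + x)) (by linarith),
      hqR _ _ (by linarith), sub_self]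
  · refine (M.finite_site_of_norm_le hε x R).subset fun ξ hξ => ?_
    by_contra hξ'
    refine hξ ?_
    simp only [Set.mem_ofPred_eq, not_le] at hξ'
    simp only [sample]
    rw [hqR _ _ hξ', hqR _ _ hξ', sub_self]

variable {Q : M.Stencil n → ℝ} (hQ : Continuous Q) (hQ0 : Q 0 = 0)
  (hQv : ∀ v : M.Displacement n, M.IsTestDisplacement v → 0 ≤ ∑' ξ : M.L, Q (M.D v ξ))

include hZ hq in
theorem continuous_differenceStencil (ε : ℝ) : Continuous (M.differenceStencil ε Z q) := by
  have := hZ.continuous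
  unfold differenceStencil
  fun_prop

include hZ hq hZR hqR hQ hQ0 hQv in
theorem integral_differenceStencil_nonneg {ε : ℝ} (hε : 0 < ε) :
    0 ≤ ∫ x, Q (M.differenceStencil ε Z q x) := by
  obtain ⟨P, hP⟩ := M.exists_bond_bound
  have hcont : Continuous fun x => Q (M.differenceStencil ε Z q x) :=
    hQ.comp (M.continuous_differenceStencil hZ hq ε)
  have hcs : HasCompactSupport fun x => Q (M.differenceStencil ε Z q x) := by
    refine HasCompactSupport.intro (isCompact_closedBall (0 : E d) (R + ε * P)) fun x hx => ?_
    simp only [Metric.mem_closedBall, dist_zero_right, not_le] at hx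
    rw [M.differenceStencil_eq_zero hZ hZR hqR fun r => ?_, hQ0]
    have : ε * ‖(r.1.1 : E d)‖ ≤ ε * P := mul_le_mul_of_nonneg_left (hP r) hε.le
    rw [norm_smul, Real.norm_of_nonneg hε.le]
    linarith
  have hint := hcont.integrable_of_hasCompactSupport (μ := volume) hcs
  -- Every offset `x` gives its own test displacement, so the lattice sum is nonnegative at each
  -- `x`. Rescaling by `ε` afterwards costs only a positive factor.
  have h := integral_nonneg_of_tsum_nonneg M.F M.isUnit_det_F (hint.comp_smul hε.ne') fun x => by
    have := hQv _ (M.isTestDisplacement_sample hZ hZR hqR hε x)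
    simpa only [D_sample] using this
  have e := Measure.integral_comp_smul volume (fun x => Q (M.differenceStencil ε Z q x)) ε
  rw [e, smul_eq_mul] at h
  exact nonneg_of_mul_nonneg_right h (by positivity)

include hZ hq hZR hqR hQ hQ0 hQv in
/-- Nonnegativity of a form on lattice test displacements passes to regular continuum fields. -/
theorem integral_continuumStencil_nonneg_of_regular :
    0 ≤ ∫ x, Q (M.continuumStencil (fderiv ℝ Z, q) x) := by
  obtain ⟨P, hP⟩ := M.exists_bond_bound
  obtain ⟨L, hL⟩ := (hZ.continuous_fderiv (by norm_num)).bounded_above_of_compact_support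
    (HasCompactSupport.intro (isCompact_closedBall (0 : E d) R) fun x hx =>
      hZR x (by simpa using hx))
  have hqb : ∀ α, ∃ C, ∀ x, ‖q α x‖ ≤ C := fun α =>
    (hq α).bounded_above_of_compact_support
    (HasCompactSupport.intro (isCompact_closedBall (0 : E d) R) fun x hx =>
      hqR α x (by simpa using hx))
  choose Cq hCq using hqb
  have hL0 : 0 ≤ L := (norm_nonneg _).trans (hL 0)
  have hCq0 : ∀ α, 0 ≤ Cq α := fun α => (norm_nonneg _).trans (hCq α 0)
  -- A bound on the stencil uniform in `ε`: the mean value inequality for the quotient, one sum for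
  -- each of the two shift terms.
  set B : ℝ := L * |P| + ∑ α, Cq α + ∑ α, Cq α with hB
  have hB0 : 0 ≤ B := by
    have := Finset.sum_nonneg fun α (_ : α ∈ Finset.univ) => hCq0 α
    positivity
  obtain ⟨C, hC⟩ := (isCompact_closedBall (0 : M.Stencil n) B).exists_bound_of_continuousOn
    hQ.continuousOn
  have hbound : ∀ ε : ℝ, 0 < ε → ∀ x, ‖M.differenceStencil ε Z q x‖ ≤ B := by
    intro ε hε x
    refine (pi_norm_le_iff_of_nonneg hB0).2 fun r => ?_
    have h1 : ‖ε⁻¹ • (Z (x + ε • (r.1.1 : E d)) - Z x)‖ ≤ L * |P| := by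
      have := Convex.norm_image_sub_le_of_norm_fderiv_le (𝕜 := ℝ) (f := Z)
        (s := Set.univ) (C := L) (x := x) (y := x + ε • (r.1.1 : E d))
        (fun y _ => (hZ.differentiable (by norm_num)) y) (fun y _ => hL y) convex_univ
        trivial trivial
      rw [add_sub_cancel_left, norm_smul, Real.norm_of_nonneg hε.le] at this
      rw [norm_smul, norm_inv, Real.norm_of_nonneg hε.le, inv_mul_le_iff₀ hε]
      calc _ ≤ _ := this
        _ = ε * (L * ‖(r.1.1 : E d)‖) := by ring
        _ ≤ _ := by gcongr; exact (hP r).trans (le_abs_self P)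
    have hs : ∀ α y, ‖q α y‖ ≤ ∑ α, Cq α := fun α y =>
      (hCq α y).trans (Finset.single_le_sum (fun α _ => hCq0 α) (Finset.mem_univ α))
    calc _ ≤ _ := norm_sub_le _ _
      _ ≤ _ := add_le_add ((norm_add_le _ _).trans (add_le_add h1 (hs _ _))) (hs _ _)
  have hlim : Filter.Tendsto (fun ε : ℝ => ∫ x, Q (M.differenceStencil ε Z q x))
      (nhdsWithin 0 (Set.Ioi 0)) (nhds (∫ x, Q (M.continuumStencil (fderiv ℝ Z, q) x))) := by
    -- For `ε ≤ 1` all integrands vanish outside one fixed ball, so a constant on that ball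
    -- dominates.
    refine tendsto_integral_filter_of_dominated_convergence
      ((Metric.closedBall (0 : E d) (R + |P|)).indicator fun _ => C) ?_ ?_ ?_ ?_
    · exact Filter.Eventually.of_forall fun ε =>
        (hQ.comp (M.continuous_differenceStencil hZ hq ε)).aestronglyMeasurable
    · filter_upwards [Ioc_mem_nhdsGT (show (0 : ℝ) < 1 by norm_num)] with ε hε
      refine Filter.Eventually.of_forall fun x => ?_
      by_cases hx : x ∈ Metric.closedBall (0 : E d) (R + |P|)
      · rw [Set.indicator_of_mem hx]
        exact hC _ (by simpa using hbound ε hε.1 x)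
      · rw [Set.indicator_of_notMem hx]
        simp only [Metric.mem_closedBall, dist_zero_right, not_le] at hx
        rw [M.differenceStencil_eq_zero hZ hZR hqR fun r => ?_, hQ0, norm_zero]
        have h1 : ε * ‖(r.1.1 : E d)‖ ≤ 1 * |P| :=
          mul_le_mul hε.2 ((hP r).trans (le_abs_self P)) (norm_nonneg _) zero_le_one
        rw [norm_smul, Real.norm_of_nonneg hε.1.le]
        linarith
    · exact (integrable_indicator_iff Metric.isClosed_closedBall.measurableSet).2
        (integrableOn_const measure_closedBall_lt_top.ne)
    · refine Filter.Eventually.of_forall fun x => (hQ.tendsto _).comp ?_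
      refine tendsto_pi_nhds.2 fun r => ?_
      have h1 := (((hZ.differentiable (by norm_num)) x).hasFDerivAt.hasLineDerivAt
        (r.1.1 : E d)).tendsto_slope_zero_right
      have h2 : Filter.Tendsto (fun ε : ℝ => q r.1.2.2 (x + ε • (r.1.1 : E d)))
          (nhdsWithin 0 (Set.Ioi 0)) (nhds (q r.1.2.2 x)) := by
        have : Continuous fun ε : ℝ => q r.1.2.2 (x + ε • (r.1.1 : E d)) :=
          (hq _).comp (continuous_const.add (continuous_id.smul continuous_const))
        simpa using (this.tendsto 0).mono_left nhdsWithin_le_nhds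
      exact (h1.add h2).sub tendsto_const_nhds
  refine ge_of_tendsto hlim ?_
  filter_upwards [self_mem_nhdsWithin] with ε hε
  exact M.integral_differenceStencil_nonneg hZ hq hZR hqR hQ hQ0 hQv hε

end Smooth

end Multilattice

open scoped Convolution

/-! ### Mollification of weakly differentiable and square-integrable fields -/

section Mollify

variable {d : ℕ} {Y : Type*} [NormedAddCommGroup Y] [NormedSpace ℝ Y]

/-- Mollification of `f` by a normalized smooth bump function. -/
def mollify (φ : ContDiffBump (0 : E d)) (f : E d → Y) : E d → Y :=
  φ.normed volume ⋆[ContinuousLinearMap.lsmul ℝ ℝ, volume] f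

variable (φ : ContDiffBump (0 : E d)) {f : E d → Y}

theorem mollify_apply (f : E d → Y) (x : E d) :
    mollify φ f x = ∫ t, φ.normed volume t • f (x - t) := rfl

theorem contDiff_mollify (hf : LocallyIntegrable f) : ContDiff ℝ 1 (mollify φ f) :=
  φ.hasCompactSupport_normed.contDiff_convolution_left (n := 1) _ φ.contDiff_normed hf

theorem integrable_mollify_integrand (hf : LocallyIntegrable f) (x : E d) :
    Integrable fun t => φ.normed volume t • f (x - t) :=
  φ.hasCompactSupport_normed.convolutionExists_left (ContinuousLinearMap.lsmul ℝ ℝ)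
    φ.continuous_normed hf x

theorem mollify_eq_zero {R : ℝ} (hR : ∀ᵐ x, R < ‖x‖ → f x = 0) {x : E d}
    (hx : R + φ.rOut < ‖x‖) : mollify φ f x = 0 := by
  rw [mollify_apply]
  refine integral_eq_zero_of_ae ?_
  have h1 : ∀ᵐ t : E d, R < ‖x - t‖ → f (x - t) = 0 :=
    (quasiMeasurePreserving_sub_left volume x).ae hR
  filter_upwards [h1] with t ht
  by_cases h : t ∈ Metric.ball (0 : E d) φ.rOut
  · have h2 := norm_sub_norm_le x t
    rw [ht (by simp at h; linarith), smul_zero]; rfl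
  · rw [← φ.support_normed_eq (μ := volume), Function.notMem_support] at h
    rw [h, zero_smul]; rfl

/-- Jensen for the square: the variance of `u` under the probability density `w` is nonnegative. -/
theorem sq_integral_le {X : Type*} [MeasurableSpace X] {μ : Measure X} {w u : X → ℝ}
    (hw : 0 ≤ w) (hwi : Integrable w μ) (hw1 : ∫ x, w x ∂μ = 1)
    (hu : Integrable (fun x => w x * u x) μ) (hu2 : Integrable (fun x => w x * u x ^ 2) μ) :
    (∫ x, w x * u x ∂μ) ^ 2 ≤ ∫ x, w x * u x ^ 2 ∂μ := by
  set a := ∫ x, w x * u x ∂μ with ha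
  have h : 0 ≤ ∫ x, w x * (u x - a) ^ 2 ∂μ :=
    integral_nonneg fun x => mul_nonneg (hw x) (sq_nonneg _)
  have e : (fun x => w x * (u x - a) ^ 2) =
      fun x => w x * u x ^ 2 - 2 * a * (w x * u x) + a ^ 2 * w x := by
    funext x; ring
  have e2 : ∫ x, w x * (u x - a) ^ 2 ∂μ = ∫ x, w x * u x ^ 2 ∂μ - 2 * a * a + a ^ 2 * 1 := by
    have hu' := hu.const_mul (2 * a)
    have hs : Integrable (fun x => w x * u x ^ 2 - 2 * a * (w x * u x)) μ := hu2.sub hu'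
    rw [e, integral_add hs (hwi.const_mul _), integral_sub hu2 hu', integral_const_mul, integral_const_mul, hw1]
  nlinarith

theorem norm_mollify_sq_le (hf : LocallyIntegrable f) (hf2 : LocallyIntegrable fun x => ‖f x‖ ^ 2)
    (x : E d) : ‖mollify φ f x‖ ^ 2 ≤ mollify φ (fun x => ‖f x‖ ^ 2) x := by
  have e : ∀ t, ‖φ.normed volume t • f (x - t)‖ = φ.normed volume t * ‖f (x - t)‖ := fun t => by
    rw [norm_smul, Real.norm_of_nonneg (φ.nonneg_normed t)]
  have h1 : ‖mollify φ f x‖ ≤ ∫ t, φ.normed volume t * ‖f (x - t)‖ := by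
    rw [mollify_apply]
    simpa only [e] using
      norm_integral_le_integral_norm (μ := volume) fun t => φ.normed volume t • f (x - t)
  have h2 := sq_integral_le (fun t => φ.nonneg_normed t) (φ.integrable_normed (μ := volume))
    φ.integral_normed (u := fun t => ‖f (x - t)‖)
    ((integrable_mollify_integrand φ hf x).norm.congr (Filter.Eventually.of_forall e))
    (integrable_mollify_integrand φ hf2 x)
  exact (pow_le_pow_left₀ (norm_nonneg _) h1 2).trans h2

/-- The derivative falls on the bump; the reflected bump `y ↦ φ (x - y)` is then a test function for
the weak gradient, and the sign from the reflection cancels the one from integration by parts. -/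
theorem fderiv_mollify {n : ℕ} {Z : E d → E n} {G : E d → E d →L[ℝ] E n}
    (hZ : LocallyIntegrable Z) (hG : LocallyIntegrable G) (h : IsWeakGradient Z G) :
    fderiv ℝ (mollify φ Z) = mollify φ G := by
  funext x
  have hd := (φ.hasCompactSupport_normed (μ := volume)).hasFDerivAt_convolution_left (μ := volume)
    (ContinuousLinearMap.lsmul ℝ ℝ) (φ.contDiff_normed (n := 1) (μ := volume)) hZ x
  rw [mollify, hd.fderiv]
  ext1 e
  have hi := (φ.hasCompactSupport_normed (μ := volume).fderiv ℝ).convolutionExists_left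
    ((ContinuousLinearMap.lsmul ℝ ℝ : ℝ →L[ℝ] E n →L[ℝ] E n).precompL (E d))
    ((φ.contDiff_normed (n := 1) (μ := volume)).continuous_fderiv (by norm_num)) hZ x
  have h1 : ((fderiv ℝ (φ.normed volume) ⋆[(ContinuousLinearMap.lsmul ℝ ℝ :
      ℝ →L[ℝ] E n →L[ℝ] E n).precompL (E d), volume] Z) x) e =
      ∫ t, fderiv ℝ (φ.normed volume) t e • Z (x - t) := by
    rw [convolution_def, ContinuousLinearMap.integral_apply hi]
    rfl
  have h2 : mollify φ G x e = ∫ t, φ.normed volume t • G (x - t) e := by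
    rw [mollify_apply, ContinuousLinearMap.integral_apply (integrable_mollify_integrand φ hG x)]
    rfl
  rw [h1, h2, ← integral_sub_left_eq_self _ volume x,
    ← integral_sub_left_eq_self (fun t => φ.normed volume t • G (x - t) e) volume x]
  simp only [sub_sub_cancel]
  have hψ : ContDiff ℝ (⊤ : ℕ∞) fun y => φ.normed volume (x - y) :=
    φ.contDiff_normed.comp (contDiff_const.sub contDiff_id)
  have hψs : HasCompactSupport fun y => φ.normed volume (x - y) :=
    φ.hasCompactSupport_normed.comp_homeomorph (Homeomorph.subLeft x)
  have hψd : ∀ y, fderiv ℝ (fun y => φ.normed volume (x - y)) y e =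
      -fderiv ℝ (φ.normed volume) (x - y) e := by
    intro y
    have hb : HasFDerivAt (fun y : E d => x - y) (-ContinuousLinearMap.id ℝ (E d)) y :=
      (hasFDerivAt_id y).const_sub x
    have hf := ((φ.contDiff_normed (n := 1) (μ := volume)).differentiable (by norm_num)
      (x - y)).hasFDerivAt.comp y hb
    rw [show (fun y => φ.normed volume (x - y)) = φ.normed volume ∘ fun y => x - y from rfl,
      hf.fderiv]
    simp
  have := h _ hψ hψs e
  simp only [hψd, neg_smul, integral_neg, neg_inj] at this
  exact this

/-- If `Q` is dominated by a multiple of `‖·‖²` and has nonnegative integral along mollifications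
of an `L²` field, then it has nonnegative integral along the field. -/
theorem integral_nonneg_of_mollify [CompleteSpace Y] {Q : Y → ℝ} (hQ : Continuous Q) {C : ℝ}
    (hQC : ∀ y, |Q y| ≤ C * ‖y‖ ^ 2) (hf : Integrable f) (hf2 : Integrable fun x => ‖f x‖ ^ 2)
    (h : ∀ φ : ContDiffBump (0 : E d), 0 ≤ ∫ x, Q (mollify φ f x)) : 0 ≤ ∫ x, Q (f x) := by
  -- The fixed ratio `2` of outer to inner radius is what the almost everywhere convergence of
  -- mollifications requires.
  set φ : ℕ → ContDiffBump (0 : E d) := fun k =>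
    ⟨1 / ((k : ℝ) + 1), 2 * (1 / ((k : ℝ) + 1)), by positivity,
      by have : 0 < 1 / ((k : ℝ) + 1) := by positivity
         linarith⟩ with hφ
  have hφ0 : Filter.Tendsto (fun k => (φ k).rOut) Filter.atTop (nhds 0) := by
    simpa [hφ] using (tendsto_one_div_add_atTop_nhds_zero_nat (𝕜 := ℝ)).const_mul 2
  have hφK : ∀ᶠ k in Filter.atTop, (φ k).rOut ≤ 2 * (φ k).rIn :=
    Filter.Eventually.of_forall fun k => le_rfl
  have hlim : ∀ᵐ x, Filter.Tendsto (fun k => mollify (φ k) f x) Filter.atTop (nhds (f x)) :=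
    ContDiffBump.ae_convolution_tendsto_right_of_locallyIntegrable hφ0 hφK hf.locallyIntegrable
  have hlim2 : ∀ᵐ x, Filter.Tendsto (fun k => mollify (φ k) (fun x => ‖f x‖ ^ 2) x)
      Filter.atTop (nhds (‖f x‖ ^ 2)) :=
    ContDiffBump.ae_convolution_tendsto_right_of_locallyIntegrable hφ0 hφK hf2.locallyIntegrable
  have hC : ∀ k x, |Q (mollify (φ k) f x)| ≤ |C| * mollify (φ k) (fun x => ‖f x‖ ^ 2) x :=
    fun k x => (hQC _).trans (mul_le_mul (le_abs_self C)
      (norm_mollify_sq_le _ hf.locallyIntegrable hf2.locallyIntegrable x) (by positivity)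
      (abs_nonneg C))
  have hm2 : ∀ k, Integrable (mollify (φ k) fun x => ‖f x‖ ^ 2) := fun k =>
    (φ k).integrable_normed.integrable_convolution _ hf2
  have hm2e : ∀ k, ∫ x, mollify (φ k) (fun x => ‖f x‖ ^ 2) x = ∫ x, ‖f x‖ ^ 2 := fun k => by
    have := integral_convolution (ContinuousLinearMap.lsmul ℝ ℝ)
      ((φ k).integrable_normed (μ := volume)) hf2
    simpa [ContDiffBump.integral_normed, mollify] using this
  have hQm : ∀ k, Integrable fun x => Q (mollify (φ k) f x) := fun k =>
    ((hm2 k).const_mul |C|).mono' (hQ.comp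
      (contDiff_mollify (φ k) hf.locallyIntegrable).continuous).aestronglyMeasurable
      (Filter.Eventually.of_forall (hC k))
  have hQf : Integrable fun x => Q (f x) :=
    (hf2.const_mul C).mono' (hQ.comp_aestronglyMeasurable hf.aestronglyMeasurable)
      (Filter.Eventually.of_forall fun x => hQC (f x))
  -- Nonnegative by Jensen, hence open to Fatou. Mollifying `‖f‖ ^ 2` preserves its integral, so `∫
  -- F k ≤ |C| ∫ ‖f‖ ^ 2`; in the limit this leaves `0 ≤ ∫ Q (f x)`.
  set F : ℕ → E d → ℝ := fun k x =>
    |C| * mollify (φ k) (fun x => ‖f x‖ ^ 2) x - Q (mollify (φ k) f x) with hF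
  have hFi : ∀ k, Integrable (F k) := fun k => ((hm2 k).const_mul _).sub (hQm k)
  have hF0 : ∀ k x, 0 ≤ F k x := fun k x => sub_nonneg.2 ((le_abs_self _).trans (hC k x))
  have hFe : ∀ k, ∫⁻ x, ENNReal.ofReal (F k x) ≤ ENNReal.ofReal (|C| * ∫ x, ‖f x‖ ^ 2) := by
    intro k
    rw [← ofReal_integral_eq_lintegral_ofReal (hFi k) (Filter.Eventually.of_forall (hF0 k))]
    refine ENNReal.ofReal_le_ofReal ?_
    rw [hF, integral_sub ((hm2 k).const_mul _) (hQm k), integral_const_mul, hm2e]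
    linarith [h (φ k)]
  have hG : ∀ᵐ x, Filter.Tendsto (fun k => ENNReal.ofReal (F k x)) Filter.atTop
      (nhds (ENNReal.ofReal (|C| * ‖f x‖ ^ 2 - Q (f x)))) := by
    filter_upwards [hlim, hlim2] with x h1 h2
    exact ENNReal.tendsto_ofReal ((h2.const_mul _).sub ((hQ.tendsto _).comp h1))
  have hfatou : ∫⁻ x, ENNReal.ofReal (|C| * ‖f x‖ ^ 2 - Q (f x)) ≤
      ENNReal.ofReal (|C| * ∫ x, ‖f x‖ ^ 2) := by
    calc _ = ∫⁻ x, Filter.liminf (fun k => ENNReal.ofReal (F k x)) Filter.atTop :=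
          lintegral_congr_ae (by filter_upwards [hG] with x hx using hx.liminf_eq.symm)
      _ ≤ Filter.liminf (fun k => ∫⁻ x, ENNReal.ofReal (F k x)) Filter.atTop :=
          lintegral_liminf_le' fun k => (hFi k).aestronglyMeasurable.aemeasurable.ennreal_ofReal
      _ ≤ _ := Filter.liminf_le_of_frequently_le'
          (Filter.Eventually.of_forall hFe).frequently
  have hpos : ∀ x, 0 ≤ |C| * ‖f x‖ ^ 2 - Q (f x) := fun x => by
    have h1 := (le_abs_self _).trans (hQC (f x))
    have h2 := mul_le_mul_of_nonneg_right (le_abs_self C) (sq_nonneg ‖f x‖)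
    linarith
  have hi : Integrable fun x => |C| * ‖f x‖ ^ 2 - Q (f x) := (hf2.const_mul _).sub hQf
  rw [← ofReal_integral_eq_lintegral_ofReal hi (Filter.Eventually.of_forall hpos),
    ENNReal.ofReal_le_ofReal_iff
      (mul_nonneg (abs_nonneg _) (integral_nonneg fun x => by positivity)),
    integral_sub (hf2.const_mul _) hQf, integral_const_mul] at hfatou
  linarith

end Mollify

/-! ### Local square integrability and compact support up to null sets -/

section Fields

variable {d : ℕ} {Y : Type*} [NormedAddCommGroup Y] {f : E d → Y}

theorem MemL2Loc.locallyIntegrable (hf : MemL2Loc f) : LocallyIntegrable f := by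
  refine locallyIntegrable_iff.2 fun K hK => ?_
  have : IsFiniteMeasure (volume.restrict K) := ⟨by simpa using hK.measure_lt_top⟩
  exact (hf K hK).integrable (by norm_num)

theorem memLp_of_restrict_of_ae_eq_zero {p : ENNReal} {K : Set (E d)} (hK : MeasurableSet K)
    (hf : MemLp f p (volume.restrict K)) (h0 : ∀ᵐ x, x ∉ K → f x = 0) : MemLp f p volume := by
  refine ((memLp_indicator_iff_restrict hK).2 hf).ae_eq ?_
  filter_upwards [h0] with x hx
  by_cases h : x ∈ K
  · rw [Set.indicator_of_mem h]
  · rw [Set.indicator_of_notMem h, hx h]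

theorem MemL2Loc.memLp_two (hf : MemL2Loc f) (h : AECompactSupport f) : MemLp f 2 := by
  obtain ⟨K, hK, h0⟩ := h
  exact memLp_of_restrict_of_ae_eq_zero hK.measurableSet (hf K hK) h0

theorem AECompactSupport.integrable (hf : MemLp f 2) (h : AECompactSupport f) : Integrable f := by
  obtain ⟨K, hK, h0⟩ := h
  have : IsFiniteMeasure (volume.restrict K) := ⟨by simpa using hK.measure_lt_top⟩
  exact memLp_one_iff_integrable.1 (memLp_of_restrict_of_ae_eq_zero hK.measurableSet
    ((hf.restrict K).mono_exponent (by norm_num)) h0)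

theorem AECompactSupport.exists_radius (h : AECompactSupport f) :
    ∃ R : ℝ, ∀ᵐ x, R < ‖x‖ → f x = 0 := by
  obtain ⟨K, hK, h0⟩ := h
  obtain ⟨R, hR⟩ := hK.isBounded.subset_closedBall 0
  refine ⟨R, ?_⟩
  filter_upwards [h0] with x hx hRx
  exact hx fun hxK => lt_irrefl R (hRx.trans_le (by simpa using hR hxK))

end Fields

/-! ### The stability form, its passage to the continuum, and coercivity -/

namespace Multilattice

variable {d n S : ℕ} [NeZero S] (M : Multilattice d S)

theorem stencilNormSq_nonneg (g : M.Stencil n) : 0 ≤ M.stencilNormSq g :=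
  Finset.sum_nonneg fun _ _ => sq_nonneg _

theorem continuous_stencilNormSq : Continuous (M.stencilNormSq (n := n)) := by
  unfold stencilNormSq
  fun_prop

theorem sq_norm_le_stencilNormSq (g : M.Stencil n) (r : {r // r ∈ M.R}) :
    ‖g r‖ ^ 2 ≤ M.stencilNormSq g :=
  Finset.single_le_sum (f := fun r => ‖g r‖ ^ 2) (fun _ _ => sq_nonneg _) (Finset.mem_univ r)

theorem stencilNormSq_le (g : M.Stencil n) :
    M.stencilNormSq g ≤ Fintype.card {r // r ∈ M.R} * ‖g‖ ^ 2 := by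
  calc M.stencilNormSq g ≤ ∑ _r : {r // r ∈ M.R}, ‖g‖ ^ 2 :=
        Finset.sum_le_sum fun r _ => pow_le_pow_left₀ (norm_nonneg _) (norm_le_pi_norm g r) 2
    _ = _ := by simp

/-- Each bond difference splits into two shifts relative to species `0` and one increment of `v 0`,
all finitely supported. -/
theorem finite_support_D {v : M.Displacement n} (hv : M.IsTestDisplacement v) :
    (Function.support (M.D v)).Finite := by
  have key : ∀ r : {r // r ∈ M.R}, (Function.support fun ξ : M.L => M.D v ξ r).Finite := by
    intro r
    have h1 := (hv.2.2 r.1.2.2).preimage (f := fun ξ : M.L => ξ + r.1.1)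
      (add_left_injective r.1.1).injOn
    refine ((h1.union (hv.2.2 r.1.2.1)).union (hv.2.1 r.1.1 ⟨_, _, r.2⟩)).subset fun ξ hξ => ?_
    by_contra h
    simp only [Set.mem_union, Set.mem_preimage, Function.mem_support, not_or, not_not] at h
    refine hξ ?_
    obtain ⟨⟨h1, h2⟩, h3⟩ := h
    calc v r.1.2.2 (ξ + r.1.1) - v r.1.2.1 ξ =
        (v r.1.2.2 (ξ + r.1.1) - v 0 (ξ + r.1.1)) - (v r.1.2.1 ξ - v 0 ξ) +
          (v 0 (ξ + r.1.1) - v 0 ξ) := by abel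
      _ = 0 := by rw [h1, h2, h3]; simp
  refine (Set.finite_iUnion key).subset fun ξ hξ => ?_
  by_contra h
  simp only [Set.mem_iUnion, Function.mem_support, not_exists, not_not] at h
  exact hξ (funext h)

theorem D_smul (t : ℝ) (v : M.Displacement n) (ξ : M.L) : M.D (t • v) ξ = t • M.D v ξ := by
  funext r
  simp [D, smul_sub]

variable {Vhat : M.Stencil n → ℝ}

/-- The second variation of the lattice energy in terms of the Hessian of the site potential. -/
theorem secondVariation_atomisticEnergy (hV : ContDiff ℝ 2 Vhat) {v : M.Displacement n}
    (hv : M.IsTestDisplacement v) :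
    secondVariation (M.atomisticEnergy Vhat) v =
      ∑' ξ : M.L, fderiv ℝ (fderiv ℝ Vhat) (M.refStencil n) (M.D v ξ) (M.D v ξ) := by
  have h0 : ∀ ξ ∉ (M.finite_support_D hv).toFinset, M.D v ξ = 0 := fun ξ hξ => by
    simpa using hξ
  -- One finite set of sites carries the energy of `t • v` for every `t`, so differentiation is
  -- termwise.
  rw [tsum_eq_sum (s := (M.finite_support_D hv).toFinset) fun ξ hξ => by simp [h0 ξ hξ],
    ← iteratedDeriv_two_sum_line hV, secondVariation]
  congr 1
  funext t
  rw [atomisticEnergy, tsum_eq_sum (s := (M.finite_support_D hv).toFinset) fun ξ hξ => by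
    simp [D_smul, h0 ξ hξ, V]]
  simp only [D_smul, V]

/-- The Hessian of the site potential minus `γ` times the squared stencil norm. -/
def stabilityForm (Vhat : M.Stencil n → ℝ) (γ : ℝ) (g : M.Stencil n) : ℝ :=
  fderiv ℝ (fderiv ℝ Vhat) (M.refStencil n) g g - γ * M.stencilNormSq g

theorem continuous_stabilityForm (γ : ℝ) : Continuous (M.stabilityForm Vhat γ) := by
  have := M.continuous_stencilNormSq (n := n)
  unfold stabilityForm
  fun_prop

theorem stabilityForm_zero (γ : ℝ) : M.stabilityForm Vhat γ 0 = 0 := by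
  simp [stabilityForm, stencilNormSq]

theorem abs_stabilityForm_le (γ : ℝ) (g : M.Stencil n) :
    |M.stabilityForm Vhat γ g| ≤ (‖fderiv ℝ (fderiv ℝ Vhat) (M.refStencil n)‖ +
      |γ| * Fintype.card {r // r ∈ M.R}) * ‖g‖ ^ 2 := by
  have h1 : |fderiv ℝ (fderiv ℝ Vhat) (M.refStencil n) g g| ≤
      ‖fderiv ℝ (fderiv ℝ Vhat) (M.refStencil n)‖ * ‖g‖ * ‖g‖ :=
    ContinuousLinearMap.le_opNorm₂ (fderiv ℝ (fderiv ℝ Vhat) (M.refStencil n)) g g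
  have h2 : |γ * M.stencilNormSq g| ≤ |γ| * (Fintype.card {r // r ∈ M.R} * ‖g‖ ^ 2) := by
    rw [abs_mul, abs_of_nonneg (M.stencilNormSq_nonneg g)]
    exact mul_le_mul_of_nonneg_left (M.stencilNormSq_le g) (abs_nonneg _)
  calc _ ≤ _ := abs_sub _ _
    _ ≤ _ := add_le_add h1 h2
    _ = _ := by ring

theorem tsum_stabilityForm_nonneg (hV : ContDiff ℝ 2 Vhat) {γ : ℝ}
    (h : ∀ v : M.Displacement n, M.IsTestDisplacement v →
      γ * M.energyNormSq v ≤ secondVariation (M.atomisticEnergy Vhat) v)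
    (v : M.Displacement n) (hv : M.IsTestDisplacement v) :
    0 ≤ ∑' ξ : M.L, M.stabilityForm Vhat γ (M.D v ξ) := by
  have h1 : Summable fun ξ : M.L =>
      fderiv ℝ (fderiv ℝ Vhat) (M.refStencil n) (M.D v ξ) (M.D v ξ) :=
    summable_of_hasFiniteSupport ((M.finite_support_D hv).subset fun ξ hξ h0 => hξ (by simp [h0]))
  have h2 := h v hv
  rw [M.secondVariation_atomisticEnergy hV hv, energyNormSq] at h2
  simp only [stabilityForm]
  rw [h1.tsum_sub (hv.1.mul_left γ), tsum_mul_left]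
  linarith

theorem continuumStencil_smul (t : ℝ) (w : M.Fields n) (x : E d) :
    M.continuumStencil (t • w) x = t • M.continuumStencil w x := by
  funext r
  simp [continuumStencil, smul_sub, smul_add]

/-- The continuum stencil is a fixed linear map of the values `G x` and `q α x` at the same point,
so it commutes with averaging. -/
theorem mollify_continuumStencil (φ : ContDiffBump (0 : E d)) {G : E d → E d →L[ℝ] E n}
    {q : Fin S → E d → E n} (hG : LocallyIntegrable G) (hq : ∀ α, LocallyIntegrable (q α))
    (hg : LocallyIntegrable (M.continuumStencil (G, q))) (x : E d) :
    M.continuumStencil (mollify φ G, fun α => mollify φ (q α)) x =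
      mollify φ (M.continuumStencil (G, q)) x := by
  funext r
  have hi := integrable_mollify_integrand φ hg x
  have hGi := integrable_mollify_integrand φ hG x
  have hqi := fun α => integrable_mollify_integrand φ (hq α) x
  have h1 := (ContinuousLinearMap.proj (R := ℝ) (φ := fun _ : {r // r ∈ M.R} => E n)
    r).integral_comp_comm hi
  have h2 : mollify φ G x (r.1.1 : E d) =
      ∫ t, (φ.normed volume t • G (x - t)) (r.1.1 : E d) :=
    ContinuousLinearMap.integral_apply hGi _
  have hGi' := hGi.apply_continuousLinearMap (r.1.1 : E d)
  have h3 := integral_add hGi' (hqi r.1.2.2)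
  have hs : Integrable fun t => (φ.normed volume t • G (x - t)) (r.1.1 : E d) +
      φ.normed volume t • q r.1.2.2 (x - t) := hGi'.add (hqi r.1.2.2)
  have h4 := integral_sub hs (hqi r.1.2.1)
  rw [h3] at h4
  change mollify φ G x (r.1.1 : E d) + mollify φ (q r.1.2.2) x - mollify φ (q r.1.2.1) x = _
  rw [h2, mollify_apply φ (q r.1.2.2), mollify_apply φ (q r.1.2.1), ← h4]
  refine Eq.trans ?_ h1
  refine integral_congr_ae (Filter.Eventually.of_forall fun t => ?_)
  simp [continuumStencil, smul_sub, smul_add]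

theorem memLp_continuumStencil {p : ENNReal} {G : E d → E d →L[ℝ] E n}
    {q : Fin S → E d → E n} (hG : MemLp G p) (hq : ∀ α, MemLp (q α) p) :
    MemLp (M.continuumStencil (G, q)) p := by
  refine memLp_pi_iff.2 fun r => ?_
  have h1 : MemLp (fun x => G x (r.1.1 : E d)) p :=
    (ContinuousLinearMap.apply ℝ (E n) (r.1.1 : E d)).comp_memLp' hG
  exact (h1.add (hq _)).sub (hq _)

/-- Nonnegativity of the stability form passes from the lattice to continuum fields. -/
theorem integral_stabilityForm_nonneg {γ : ℝ}
    (h : ∀ v : M.Displacement n, M.IsTestDisplacement v →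
      0 ≤ ∑' ξ : M.L, M.stabilityForm Vhat γ (M.D v ξ))
    {Z : E d → E n} {G : E d → E d →L[ℝ] E n} {q : Fin S → E d → E n}
    (hZ : IsH1LocWithGradient Z G) (hG : AECompactSupport G) (hq : ∀ α, MemLp (q α) 2)
    (hqs : ∀ α, AECompactSupport (q α)) :
    0 ≤ ∫ x, M.stabilityForm Vhat γ (M.continuumStencil (G, q) x) := by
  have hG2 : MemLp G 2 := hZ.2.1.memLp_two hG
  have hG1 := hG.integrable hG2
  have hq1 := fun α => (hqs α).integrable (hq α)
  have hg1 : Integrable (M.continuumStencil (G, q)) := memLp_one_iff_integrable.1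
    (M.memLp_continuumStencil (memLp_one_iff_integrable.2 hG1)
      fun α => memLp_one_iff_integrable.2 (hq1 α))
  have hg2 := M.memLp_continuumStencil hG2 hq
  obtain ⟨R₀, hR₀⟩ := hG.exists_radius
  choose R hR using fun α => (hqs α).exists_radius
  refine integral_nonneg_of_mollify (M.continuous_stabilityForm γ) (M.abs_stabilityForm_le γ) hg1
    ((memLp_two_iff_integrable_sq_norm hg1.aestronglyMeasurable).1 hg2) fun φ => ?_
  -- One radius for the gradient and all shifts; absolute values because the given radii may be
  -- negative.
  have hbig : ∀ x : E d, (|R₀| + ∑ α, |R α|) + φ.rOut < ‖x‖ →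
      R₀ + φ.rOut < ‖x‖ ∧ ∀ α, R α + φ.rOut < ‖x‖ := by
    intro x hx
    have h0 : 0 ≤ ∑ α, |R α| := Finset.sum_nonneg fun _ _ => abs_nonneg _
    refine ⟨by linarith [le_abs_self R₀], fun α => ?_⟩
    have h1 := Finset.single_le_sum (f := fun α => |R α|) (fun _ _ => abs_nonneg _)
      (Finset.mem_univ α)
    linarith [le_abs_self (R α), abs_nonneg R₀]
  have := M.integral_continuumStencil_nonneg_of_regular
    (contDiff_mollify φ hZ.1.locallyIntegrable)
    (fun α => (contDiff_mollify φ (hq1 α).locallyIntegrable).continuous)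
    (R := (|R₀| + ∑ α, |R α|) + φ.rOut)
    (fun x hx => by
      rw [fderiv_mollify φ hZ.1.locallyIntegrable hG1.locallyIntegrable hZ.2.2]
      exact mollify_eq_zero φ hR₀ (hbig x hx).1)
    (fun α x hx => mollify_eq_zero φ (hR α) ((hbig x hx).2 α))
    (M.continuous_stabilityForm γ) (M.stabilityForm_zero γ) h
  rw [fderiv_mollify φ hZ.1.locallyIntegrable hG1.locallyIntegrable hZ.2.2] at this
  simpa only [M.mollify_continuumStencil φ hG1.locallyIntegrable
    (fun α => (hq1 α).locallyIntegrable) hg1.locallyIntegrable] using this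

/-- The Cauchy–Born stencil of a constant gradient `A` and constant shifts `p`. -/
def affineStencil (A : E d →L[ℝ] E n) (p : Fin S → E n) : M.Stencil n :=
  fun r => A (r.1.1 : E d) + p r.1.2.2 - p r.1.2.1

/-- On bonds `(ρ, 0, 0)` the shifts cancel and the stencil entry is `A ρ`. The controlled vectors
form a subspace, and these `ρ` span. -/
theorem exists_sq_norm_apply_le (x : E d) : ∃ C : ℝ, ∀ (A : E d →L[ℝ] E n) (p : Fin S → E n),
    ‖A x‖ ^ 2 ≤ C * M.stencilNormSq (M.affineStencil A p) := by
  have hx : x ∈ Submodule.span ℝ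
      {x : E d | ∃ ρ : bravaisLattice M.F, (ρ, (0 : Fin S), (0 : Fin S)) ∈ M.R ∧ x = (ρ : E d)} :=
    M.span_R 0 ▸ Submodule.mem_top
  induction hx using Submodule.span_induction with
  | mem x hx =>
    obtain ⟨ρ, hρ, rfl⟩ := hx
    refine ⟨1, fun A p => ?_⟩
    simpa [affineStencil] using M.sq_norm_le_stencilNormSq (M.affineStencil A p) ⟨_, hρ⟩
  | zero => exact ⟨0, fun A p => by simp⟩
  | add x y _ _ hx hy =>
    obtain ⟨C, hC⟩ := hx
    obtain ⟨C', hC'⟩ := hy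
    refine ⟨2 * C + 2 * C', fun A p => ?_⟩
    have h1 : ‖A (x + y)‖ ≤ ‖A x‖ + ‖A y‖ := by rw [map_add]; exact norm_add_le _ _
    nlinarith [hC A p, hC' A p, norm_nonneg (A (x + y)), sq_nonneg (‖A x‖ - ‖A y‖)]
  | smul a x _ hx =>
    obtain ⟨C, hC⟩ := hx
    refine ⟨a ^ 2 * C, fun A p => ?_⟩
    rw [map_smul, norm_smul, mul_pow, Real.norm_eq_abs, sq_abs, mul_assoc]
    exact mul_le_mul_of_nonneg_left (hC A p) (sq_nonneg a)

/-- The bond `(0, 0, α)` has stencil entry exactly `p α - p 0`. -/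
theorem sq_norm_sub_le_stencilNormSq (A : E d →L[ℝ] E n) (p : Fin S → E n) (α : Fin S) :
    ‖p α - p 0‖ ^ 2 ≤ M.stencilNormSq (M.affineStencil A p) := by
  by_cases h : α = 0
  · simpa [h] using M.stencilNormSq_nonneg _
  · simpa [affineStencil] using
      M.sq_norm_le_stencilNormSq (M.affineStencil A p) ⟨_, M.zero_mem_R 0 α (Ne.symm h)⟩

/-- The stencil norm controls the gradient and the relative shifts. -/
theorem exists_continuum_coercivity : ∃ K : ℝ, 0 < K ∧
    ∀ (A : E d →L[ℝ] E n) (p : Fin S → E n),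
      ∑ i : Fin d, ‖A (EuclideanSpace.single i 1)‖ ^ 2 + ∑ α, ‖p α - p 0‖ ^ 2 ≤
        K * M.stencilNormSq (M.affineStencil A p) := by
  choose C hC using fun i : Fin d => M.exists_sq_norm_apply_le (n := n) (EuclideanSpace.single i 1)
  refine ⟨∑ i, |C i| + S + 1, by positivity, fun A p => ?_⟩
  have h0 := M.stencilNormSq_nonneg (M.affineStencil A p)
  have h1 : ∑ i : Fin d, ‖A (EuclideanSpace.single i 1)‖ ^ 2 ≤
      ∑ i, |C i| * M.stencilNormSq (M.affineStencil A p) := Finset.sum_le_sum fun i _ =>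
    (hC i A p).trans (mul_le_mul_of_nonneg_right (le_abs_self _) h0)
  have h2 : ∑ α, ‖p α - p 0‖ ^ 2 ≤ ∑ _α : Fin S, M.stencilNormSq (M.affineStencil A p) :=
    Finset.sum_le_sum fun α _ => M.sq_norm_sub_le_stencilNormSq A p α
  rw [← Finset.sum_mul] at h1
  simp only [Finset.sum_const, Finset.card_univ, Fintype.card_fin, nsmul_eq_mul] at h2
  linarith

theorem integrable_stencilNormSq {X : Type*} [MeasurableSpace X] {μ : Measure X}
    {g : X → M.Stencil n} (hg : MemLp g 2 μ) : Integrable (fun x => M.stencilNormSq (g x)) μ :=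
  integrable_finsetSum _ fun r _ =>
    (memLp_two_iff_integrable_sq_norm (memLp_pi_iff.1 hg r).1).1 (memLp_pi_iff.1 hg r)

end Multilattice

end CauchyBorn

end

/-! ### Cauchy–Born stability -/

theorem theorem3p5 {d n S : ℕ} [NeZero S] (hd : d = 2 ∨ d = 3) (hn : n = d ∨ (d = 2 ∧ n = 3))
    (M : CauchyBorn.Multilattice d S) (Vhat : M.Stencil n → ℝ) (hV : M.RegularPotential Vhat)
    (hstab : M.PhononStable Vhat) :
    ∃ γ : ℝ, 0 < γ ∧
      ∀ (Z : CauchyBorn.E d → CauchyBorn.E n)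
        (G : CauchyBorn.E d → CauchyBorn.E d →L[ℝ] CauchyBorn.E n)
        (q : Fin S → CauchyBorn.E d → CauchyBorn.E n),
        CauchyBorn.IsH1LocWithGradient Z G → CauchyBorn.AECompactSupport G →
        (∀ α, MeasureTheory.MemLp (q α) 2) → (∀ α, CauchyBorn.AECompactSupport (q α)) →
        (∀ t : ℝ, MeasureTheory.Integrable
          fun x => M.V Vhat (M.continuumStencil (t • (G, q)) x)) ∧
        ContDiff ℝ 2 (fun t : ℝ => M.cauchyBornEnergy Vhat (t • (G, q))) ∧
        γ * M.continuumNormSq (G, q) ≤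
          CauchyBorn.secondVariation (M.cauchyBornEnergy Vhat) (G, q) := by
  obtain ⟨γ, hγ, hst⟩ := hstab
  obtain ⟨K, hK, hcoer⟩ := M.exists_continuum_coercivity (n := n)
  have hV2 : ContDiff ℝ 2 Vhat := hV.1.of_le (by norm_num)
  obtain ⟨C₁, hC₁⟩ := hV.2 1 le_rfl (by norm_num)
  obtain ⟨C₂, hC₂⟩ := hV.2 2 (by norm_num) (by norm_num)
  have hC₁' : ∀ g, ‖fderiv ℝ Vhat g‖ ≤ C₁ := fun g => by
    rw [← norm_iteratedFDeriv_one]; exact hC₁ g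
  have hC₂' : ∀ g, ‖fderiv ℝ (fderiv ℝ Vhat) g‖ ≤ C₂ := fun g => by
    rw [← norm_iteratedFDeriv_one, norm_iteratedFDeriv_fderiv]; exact hC₂ g
  -- Passing to the continuum keeps `γ` intact in the stencil norm; only the comparison with the
  -- continuum norm costs `K`.
  refine ⟨γ / K, by positivity, fun Z G q hZ hG hq hqs => ?_⟩
  have hG2 : MemLp G 2 := hZ.2.1.memLp_two hG
  have hg2 := M.memLp_continuumStencil hG2 hq
  have hg1 : Integrable (M.continuumStencil (G, q)) := memLp_one_iff_integrable.1
    (M.memLp_continuumStencil (memLp_one_iff_integrable.2 (hG.integrable hG2))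
      fun α => memLp_one_iff_integrable.2 ((hqs α).integrable (hq α)))
  have hgsq := (memLp_two_iff_integrable_sq_norm hg1.aestronglyMeasurable).1 hg2
  have hE : (fun t : ℝ => M.cauchyBornEnergy Vhat (t • (G, q))) = fun t : ℝ =>
      ∫ x, (Vhat (M.refStencil n + t • M.continuumStencil (G, q) x) - Vhat (M.refStencil n)) := by
    funext t
    simp only [CauchyBorn.Multilattice.cauchyBornEnergy, M.continuumStencil_smul,
      CauchyBorn.Multilattice.V]
  have hline := CauchyBorn.contDiff_two_integral_line hV2 hC₁' hC₂' (M.refStencil n) hg1 hgsq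
  refine ⟨fun t => ?_, by rw [hE]; exact hline.1, ?_⟩
  · simp only [M.continuumStencil_smul]
    exact CauchyBorn.integrable_comp_line hV2 hC₁' (M.refStencil n) hg1 t
  rw [CauchyBorn.secondVariation, hE, hline.2]
  have hN := M.integrable_stencilNormSq hg2
  have hB : Integrable fun x => fderiv ℝ (fderiv ℝ Vhat) (M.refStencil n)
      (M.continuumStencil (G, q) x) (M.continuumStencil (G, q) x) := by
    refine (hgsq.const_mul ‖fderiv ℝ (fderiv ℝ Vhat) (M.refStencil n)‖).mono' ?_
      (Filter.Eventually.of_forall fun x => ?_)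
    · have hc : Continuous fun g : M.Stencil n =>
          fderiv ℝ (fderiv ℝ Vhat) (M.refStencil n) g g := by fun_prop
      exact hc.comp_aestronglyMeasurable hg1.aestronglyMeasurable
    · rw [pow_two, ← mul_assoc]
      exact ContinuousLinearMap.le_opNorm₂ _ _ _
  have hmain := M.integral_stabilityForm_nonneg (M.tsum_stabilityForm_nonneg hV2 hst) hZ hG hq hqs
  simp only [CauchyBorn.Multilattice.stabilityForm] at hmain
  rw [integral_sub hB (hN.const_mul γ), integral_const_mul] at hmain
  have hGi : ∀ i : Fin d, Integrable fun x => ‖G x (EuclideanSpace.single i 1)‖ ^ 2 := fun i => by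
    have := (ContinuousLinearMap.apply ℝ (CauchyBorn.E n)
      (EuclideanSpace.single i (1 : ℝ) : CauchyBorn.E d)).comp_memLp' hG2
    exact (memLp_two_iff_integrable_sq_norm this.1).1 this
  have hqi : ∀ α : Fin S, Integrable fun x => ‖q α x - q 0 x‖ ^ 2 := fun α => by
    have := (hq α).sub (hq 0)
    exact (memLp_two_iff_integrable_sq_norm this.1).1 this
  have hnorm : M.continuumNormSq (G, q) ≤
      K * ∫ x, M.stencilNormSq (M.continuumStencil (G, q) x) := by
    have hGs := integrable_finsetSum Finset.univ fun i _ => hGi i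
    have hqs' := integrable_finsetSum Finset.univ fun α _ => hqi α
    rw [CauchyBorn.Multilattice.continuumNormSq, ← integral_finsetSum _ fun α _ => hqi α,
      ← integral_add hGs hqs', ← integral_const_mul]
    exact integral_mono (hGs.add hqs') (hN.const_mul K) fun x => hcoer (G x) fun α => q α x
  calc γ / K * M.continuumNormSq (G, q) ≤
      γ / K * (K * ∫ x, M.stencilNormSq (M.continuumStencil (G, q) x)) := by gcongr
    _ = γ * ∫ x, M.stencilNormSq (M.continuumStencil (G, q) x) := by field_simp
    _ ≤ _ := by linarith
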